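/- Let $R$ be a finite associative ring with identity and $|R|\neq 2$. Its unitary Cayley graph $G_R$ is the simple graph with vertex set $R$ in which two distinct elements $a,b$ are adjacent if and only if $a-b$ is a unit of $R$. A set $X$ of vertices of a graph is homogeneous if every vertex outside $X$ is adjacent either to all or to none of the vertices of $X$; the graph is prime if it has no homogeneous set $X$ with at least two elements other than the whole vertex set. Let $\mathrm{Rad}(R)$ be the Jacobson radical of $R$ and $R^{\mathrm{ss}}=R/\mathrm{Rad}(R)$. Then $R^{\mathrm{ss}}$ has an Artin–Wedderburn decomposition $$R^{\mathrm{ss}}\;\cong\;\prod_{i=1}^{s}R_i\;\times\;\prod_{j=1}^{r}M_{d_j}(F_j),\qquad s,r\ge 0,$$ where the $R_i$ and $F_j$ are finite fields and all $d_j\ge 2$; and for every such decomposition, $G_R$ is prime if and only if the following three conditions hold: 1. $\mathrm{Rad}(R)=0$, that is, $R=R^{\mathrm{ss}}$ is semisimple; 2. there is at most one $i\in\{1,\dots,s\}$ with $|R_i|=2$; 3. $R^{\mathrm{ss}}$ is not a field. Moreover, $R^{\mathrm{ss}}$ is a field if and only if $s=1$ and $r=0$. -/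

import Mathlib

universe u

/-- A set `X` of vertices is homogeneous if every vertex outside `X` is adjacent either to all
vertices of `X` or to none of them. -/
def SimpleGraph.IsHomogeneousSet {V : Type*} (G : SimpleGraph V) (X : Set V) : Prop :=
  ∀ v : V, v ∉ X → (∀ x ∈ X, G.Adj v x) ∨ (∀ x ∈ X, ¬ G.Adj v x)

/-- A graph is prime if it has no non-trivial homogeneous set: every homogeneous set with at least
two elements is the whole vertex set. -/
def SimpleGraph.IsPrimeGraph {V : Type*} (G : SimpleGraph V) : Prop :=
  ∀ X : Set V, G.IsHomogeneousSet X → X.Nontrivial → X = Set.univ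

/-- The unitary Cayley graph of a ring `R`: the Cayley graph of `(R, +)` whose generating set is
the set of units of `R`. -/
def unitaryCayleyGraph (R : Type*) [Ring R] : SimpleGraph R :=
  SimpleGraph.circulantGraph {x : R | IsUnit x}

theorem unitaryCayleyGraph_adj {R : Type*} [Ring R] (a b : R) :
    (unitaryCayleyGraph R).Adj a b ↔ a ≠ b ∧ IsUnit (a - b) := by
  have h : IsUnit (b - a) ↔ IsUnit (a - b) := by rw [← neg_sub, IsUnit.neg_iff]
  simp [unitaryCayleyGraph, SimpleGraph.circulantGraph, SimpleGraph.fromRel_adj, h]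

/-- In a nontrivial ring `0` is not a unit, so adjacency just means that `a - b` is a unit. -/
theorem unitaryCayleyGraph_adj_of_nontrivial {R : Type*} [Ring R] [Nontrivial R] (a b : R) :
    (unitaryCayleyGraph R).Adj a b ↔ IsUnit (a - b) := by
  rw [unitaryCayleyGraph_adj, and_iff_right_iff_imp]
  rintro h rfl
  simp at h

/-- The quotient `R / Rad(R)` of a ring by its Jacobson radical. -/
abbrev SemisimpleQuotient (R : Type*) [Ring R] : Type _ := R ⧸ Ring.jacobson R

/-- An Artin–Wedderburn decomposition of a finite ring `A`:
`A ≅ ∏_{i < s} K i × ∏_{j < r} M_{d j}(F j)` with finite fields `K i`, `F j` and all `d j ≥ 2`. -/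
structure ArtinWedderburnDecomposition (A : Type u) [Ring A] where
  s : ℕ
  r : ℕ
  K : Fin s → Type u
  [fieldK : ∀ i, Field (K i)]
  [finiteK : ∀ i, Finite (K i)]
  d : Fin r → ℕ
  two_le_d : ∀ j, 2 ≤ d j
  F : Fin r → Type u
  [fieldF : ∀ j, Field (F j)]
  [finiteF : ∀ j, Finite (F j)]
  equiv : A ≃+* (∀ i, K i) × (∀ j, Matrix (Fin (d j)) (Fin (d j)) (F j))

/-! Sufficiency: let `X` be a maximal proper homogeneous set containing `0`. Overlapping homogeneous
sets have homogeneous union, so a graph automorphism whose preimage of `X` meets `X` maps that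
preimage into `X`, unless the two cover the graph; that is excluded when the graph and its
complement are connected, i.e. when units and non-units each generate `(R, +)`. Translations and
unit multiplications then make `X` a left ideal; `1` is adjacent to `0`, hence to all of `X`, so `X`
lies in the radical, which is zero (`unitaryCayleyGraph_isPrimeGraph`). Non-units generate thanks to
a nontrivial idempotent, units by `addSubgroupClosure_units_prod_matrix_eq_top`. Necessity: the
radical is homogeneous, a field gives a complete graph, and two quotients of order two disconnect
the graph. -/

namespace SimpleGraph

/-! ### Homogeneous sets in graphs. -/

variable {V : Type*} {G : SimpleGraph V} {X Y : Set V}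

theorem IsHomogeneousSet.preimage (hX : G.IsHomogeneousSet X) (e : G ≃g G) :
    G.IsHomogeneousSet (e ⁻¹' X) := by
  intro v hv
  refine (hX (e v) hv).imp (fun h x hx => ?_) (fun h x hx hvx => ?_)
  · exact e.map_adj_iff.1 (h _ hx)
  · exact h _ hx (e.map_adj_iff.2 hvx)

theorem IsHomogeneousSet.union (hX : G.IsHomogeneousSet X) (hY : G.IsHomogeneousSet Y)
    (h : (X ∩ Y).Nonempty) : G.IsHomogeneousSet (X ∪ Y) := by
  obtain ⟨z, hzX, hzY⟩ := h
  intro v hv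
  rw [Set.mem_union, not_or] at hv
  rcases hX v hv.1 with h1 | h1 <;> rcases hY v hv.2 with h2 | h2
  · exact Or.inl fun x hx => hx.elim (h1 x) (h2 x)
  · exact absurd (h1 z hzX) (h2 z hzY)
  · exact absurd (h2 z hzY) (h1 z hzX)
  · exact Or.inr fun x hx => hx.elim (h1 x) (h2 x)

/-- If two proper homogeneous sets cover the graph, then the first one is either completely joined
to its complement or completely separated from it. -/
theorem IsHomogeneousSet.join_or_disjoint_of_union_eq_univ (hX : G.IsHomogeneousSet X)
    (hY : G.IsHomogeneousSet Y) (hYu : Y ≠ Set.univ) (h : X ∪ Y = Set.univ) :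
    (∀ v ∉ X, ∀ x ∈ X, G.Adj v x) ∨ (∀ v ∉ X, ∀ x ∈ X, ¬ G.Adj v x) := by
  obtain ⟨w, hw⟩ := (Set.ne_univ_iff_exists_notMem Y).1 hYu
  have cover : ∀ v, v ∈ X ∨ v ∈ Y := fun v => by
    have : v ∈ X ∪ Y := h ▸ Set.mem_univ v
    exact this
  have hwX : w ∈ X := (cover w).resolve_right hw
  refine (hY w hw).imp (fun hwY v hv => ?_) (fun hwY v hv => ?_)
  · have hvw := (hwY v ((cover v).resolve_left hv)).symm
    exact (hX v hv).resolve_right fun h' => h' w hwX hvw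
  · have hvw := hwY v ((cover v).resolve_left hv)
    exact (hX v hv).resolve_left fun h' => hvw (h' w hwX).symm

end SimpleGraph

/-- With `T` the units or the non-units, this yields connectedness of the graph or of its
complement. -/
theorem Set.eq_univ_of_addSubgroupClosure_eq_top {A : Type*} [AddGroup A] {T S : Set A}
    (hT : AddSubgroup.closure T = ⊤) (hS : S.Nonempty)
    (h : ∀ t ∈ T, ∀ x, x ∈ S ↔ x + t ∈ S) : S = Set.univ := by
  have key : ∀ r : A, ∀ x, x ∈ S ↔ x + r ∈ S := by
    intro r
    have hr : r ∈ AddSubgroup.closure T := hT ▸ AddSubgroup.mem_top r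
    induction hr using AddSubgroup.closure_induction with
    | mem t ht => exact h t ht
    | zero => simp
    | add a b _ _ ha hb => intro x; rw [ha, hb, add_assoc]
    | neg a _ ha => intro x; rw [ha (x + -a), neg_add_cancel_right]
  obtain ⟨s, hs⟩ := hS
  refine Set.eq_univ_of_forall fun y => ?_
  simpa using (key (-s + y) s).1 hs

/-! ### Primeness criterion for the unitary Cayley graph. -/

section Ring

variable {R : Type*} [Ring R]

/-- In `r = r * e + r * (1 - e)` both summands are killed on the right by a nonzero element. -/
theorem closure_nonunits_eq_top_of_isIdempotentElem {e : R} (he : IsIdempotentElem e) (h0 : e ≠ 0)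
    (h1 : e ≠ 1) : AddSubgroup.closure {x : R | ¬ IsUnit x} = ⊤ := by
  refine eq_top_iff.2 fun r _ => ?_
  have key : ∀ f : R, IsIdempotentElem f → f ≠ 1 →
      r * f ∈ AddSubgroup.closure {x : R | ¬ IsUnit x} := by
    refine fun f hf hf1 => AddSubgroup.subset_closure fun hu => hf1 ?_
    have h2 : r * f * (f - 1) = 0 := by rw [mul_assoc, mul_sub, hf.eq, mul_one, sub_self, mul_zero]
    exact sub_eq_zero.1 ((hu.mul_right_eq_zero).1 h2)
  have : r = r * e + r * (1 - e) := by rw [← mul_add, add_sub_cancel, mul_one]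
  rw [this]
  exact add_mem (key e he h1) (key _ he.one_sub fun h => h0 (by simpa using h))

/-- Translation as an automorphism of the unitary Cayley graph. -/
def unitaryCayleyGraph.addRight (a : R) : unitaryCayleyGraph R ≃g unitaryCayleyGraph R where
  toEquiv := Equiv.addRight a
  map_rel_iff' := by intro x y; simp [unitaryCayleyGraph_adj]

/-- Left multiplication by a unit as an automorphism of the unitary Cayley graph. -/
def unitaryCayleyGraph.mulLeft (u : Rˣ) : unitaryCayleyGraph R ≃g unitaryCayleyGraph R where
  toEquiv := u.mulLeft
  map_rel_iff' := by intro x y; simp [unitaryCayleyGraph_adj, ← mul_sub]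

theorem mem_jacobson_of_forall_isUnit_one_sub_mul {x : R} (h : ∀ y, IsUnit (1 - y * x)) :
    x ∈ Ring.jacobson R := by
  rw [← Ideal.jacobson_bot, Ideal.mem_jacobson_iff]
  intro y
  obtain ⟨z, hz⟩ := (h (-y)).exists_left_inv
  refine ⟨z, ?_⟩
  rw [Ideal.mem_bot, ← hz]
  noncomm_ring

theorem unitaryCayleyGraph_exists_adj_of_closure_units
    (hR : AddSubgroup.closure {x : R | IsUnit x} = ⊤) {S : Set R} (hS : S.Nonempty)
    (hSu : S ≠ Set.univ) : ∃ v ∉ S, ∃ x ∈ S, (unitaryCayleyGraph R).Adj v x := by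
  by_contra! h
  refine hSu (Set.eq_univ_of_addSubgroupClosure_eq_top hR hS fun t ht x => ?_)
  rcases subsingleton_or_nontrivial R with _ | _
  · rw [Subsingleton.elim (x + t) x]
  have h1 : (unitaryCayleyGraph R).Adj (x + t) x := by
    rw [unitaryCayleyGraph_adj_of_nontrivial]; simpa using ht
  exact ⟨fun hx => by_contra fun hxt => h _ hxt _ hx h1,
    fun hxt => by_contra fun hx => h _ hx _ hxt h1.symm⟩

theorem unitaryCayleyGraph_exists_not_adj_of_closure_nonunits
    (hR : AddSubgroup.closure {x : R | ¬ IsUnit x} = ⊤) {S : Set R} (hS : S.Nonempty)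
    (hSu : S ≠ Set.univ) : ∃ v ∉ S, ∃ x ∈ S, ¬ (unitaryCayleyGraph R).Adj v x := by
  by_contra! h
  refine hSu (Set.eq_univ_of_addSubgroupClosure_eq_top hR hS fun t ht x => ?_)
  have h1 : ¬ (unitaryCayleyGraph R).Adj (x + t) x := by
    rw [unitaryCayleyGraph_adj]; simpa using fun _ => ht
  exact ⟨fun hx => by_contra fun hxt => h1 (h _ hxt _ hx),
    fun hxt => by_contra fun hx => h1 (h _ hx _ hxt).symm⟩

/-- A maximal proper homogeneous set containing `0` is a left ideal contained in the Jacobson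
radical, provided that both the units and the non-units generate the additive group. -/
theorem unitaryCayleyGraph_isPrimeGraph [Finite R] (hJ : Ring.jacobson R = ⊥)
    (hU : AddSubgroup.closure {x : R | IsUnit x} = ⊤)
    (hN : AddSubgroup.closure {x : R | ¬ IsUnit x} = ⊤) :
    (unitaryCayleyGraph R).IsPrimeGraph := by
  intro X₀ hX₀ hX₀n
  by_contra hX₀u
  obtain ⟨a, ha⟩ := hX₀n.nonempty
  have : Nontrivial R := Set.nontrivial_of_nontrivial hX₀n
  let X₁ := unitaryCayleyGraph.addRight a ⁻¹' X₀
  have hX₁ : (unitaryCayleyGraph R).IsHomogeneousSet X₁ := hX₀.preimage _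
  have preimage_ne : ∀ (e : unitaryCayleyGraph R ≃g unitaryCayleyGraph R) (Y : Set R),
      Y ≠ Set.univ → e ⁻¹' Y ≠ Set.univ := fun e Y hY h => hY <| by
    rw [← Set.image_preimage_eq Y e.surjective, h, Set.image_univ, e.surjective.range_eq]
  obtain ⟨X, hle, hmax⟩ := (Set.toFinite {Y : Set R | (unitaryCayleyGraph R).IsHomogeneousSet Y ∧
    Y ≠ Set.univ}).exists_le_maximal (show X₁ ∈ _ from ⟨hX₁, preimage_ne _ _ hX₀u⟩)
  obtain ⟨hX, hXu⟩ := hmax.prop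
  have h0 : (0 : R) ∈ X := hle (by simpa [X₁, unitaryCayleyGraph.addRight] using ha)
  -- By maximality of `X`, `e ⁻¹' X ⊆ X` as soon as the two sets meet.
  have hsub : ∀ e : unitaryCayleyGraph R ≃g unitaryCayleyGraph R, ∀ z ∈ X, e z ∈ X →
      ∀ y, e y ∈ X → y ∈ X := by
    intro e z hz hez
    have hY := hX.preimage e
    have hYu := preimage_ne e X hXu
    have hun : X ∪ e ⁻¹' X ≠ Set.univ := fun h => by
      rcases hX.join_or_disjoint_of_union_eq_univ hY hYu h with h | h
      · obtain ⟨v, hv, x, hx, hvx⟩ :=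
          unitaryCayleyGraph_exists_not_adj_of_closure_nonunits hN ⟨0, h0⟩ hXu
        exact hvx (h v hv x hx)
      · obtain ⟨v, hv, x, hx, hvx⟩ :=
          unitaryCayleyGraph_exists_adj_of_closure_units hU ⟨0, h0⟩ hXu
        exact h v hv x hx hvx
    have := hmax.le_of_ge (show X ∪ e ⁻¹' X ∈ _ from ⟨hX.union hY ⟨z, hz, hez⟩, hun⟩)
      Set.subset_union_left
    exact fun y hy => this (Or.inr hy)
  have hneg_add : ∀ x ∈ X, ∀ y, y + x ∈ X → y ∈ X := fun x hx =>
    hsub (unitaryCayleyGraph.addRight x) 0 h0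
      (by simpa [unitaryCayleyGraph.addRight] using hx)
  have hneg : ∀ x ∈ X, -x ∈ X := fun x hx => hneg_add x hx _ (by simpa using h0)
  have hadd : ∀ x ∈ X, ∀ y ∈ X, x + y ∈ X := fun x hx y hy =>
    hneg_add (-y) (hneg y hy) _ (by simpa using hx)
  have hunit : ∀ u : R, IsUnit u → ∀ x ∈ X, u * x ∈ X := by
    rintro _ ⟨u, rfl⟩ x hx
    -- The inverse appears because `hsub` concerns preimages: `u⁻¹ * (u * x) = x` lies in `X`.
    exact hsub (unitaryCayleyGraph.mulLeft u⁻¹) 0 h0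
      (by simpa [unitaryCayleyGraph.mulLeft] using h0) _
      (by simpa [unitaryCayleyGraph.mulLeft] using hx)
  have hmul : ∀ r : R, ∀ x ∈ X, r * x ∈ X := by
    intro r x hx
    have hr : r ∈ AddSubgroup.closure {x : R | IsUnit x} := hU ▸ AddSubgroup.mem_top r
    induction hr using AddSubgroup.closure_induction with
    | mem t ht => exact hunit t ht x hx
    | zero => simpa using h0
    | add a b _ _ ha hb => rw [add_mul]; exact hadd _ ha _ hb
    | neg a _ ha => rw [neg_mul]; exact hneg _ ha
  have h1 : (1 : R) ∉ X := fun h1 => hXu <| Set.eq_univ_of_forall fun r => by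
    simpa using hmul r 1 h1
  have hone_sub : ∀ x ∈ X, IsUnit (1 - x) := by
    have := (hX 1 h1).resolve_right fun h => h 0 h0 (by
      rw [unitaryCayleyGraph_adj_of_nontrivial]; simp)
    exact fun x hx => (unitaryCayleyGraph_adj_of_nontrivial _ _).1 (this x hx)
  have hzero : ∀ x ∈ X, x = 0 := fun x hx => by
    rw [← Ideal.mem_bot, ← hJ]
    exact mem_jacobson_of_forall_isUnit_one_sub_mul fun y => hone_sub _ (hmul y x hx)
  obtain ⟨b, hb, hba⟩ := hX₀n.exists_ne a
  have : b - a ∈ X := hle (by simpa [X₁, unitaryCayleyGraph.addRight] using hb)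
  exact hba (sub_eq_zero.1 (hzero _ this))

/-! ### Obstructions to primeness. -/

theorem isUnit_add_of_mem_jacobson [Finite R] {u x : R} (hu : IsUnit u)
    (hx : x ∈ Ring.jacobson R) : IsUnit (u + x) := by
  obtain ⟨u, rfl⟩ := hu
  rw [← Ideal.jacobson_bot, Ideal.mem_jacobson_iff] at hx
  obtain ⟨z, hz⟩ := hx (u⁻¹ : Rˣ)
  have hz' : z * (u⁻¹ : Rˣ) * (u + x) = 1 := by
    rw [Ideal.mem_bot, sub_eq_zero] at hz
    rw [mul_add, mul_assoc, Units.inv_mul, mul_one, add_comm, hz]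
  -- In a finite ring a left inverse is two-sided.
  exact IsUnit.of_mul_eq_one_right _ hz'

/-- The Jacobson radical is a homogeneous set. -/
theorem unitaryCayleyGraph_isHomogeneousSet_jacobson [Finite R] :
    (unitaryCayleyGraph R).IsHomogeneousSet (Ring.jacobson R : Set R) := by
  intro v hv
  have hne : ∀ x ∈ Ring.jacobson R, v ≠ x := fun x hx h => hv (h ▸ hx)
  by_cases h : IsUnit v
  · refine Or.inl fun x hx => (unitaryCayleyGraph_adj _ _).2 ⟨hne x hx, ?_⟩
    rw [sub_eq_add_neg]
    exact isUnit_add_of_mem_jacobson h (neg_mem hx)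
  · refine Or.inr fun x hx hvx => h ?_
    simpa using isUnit_add_of_mem_jacobson ((unitaryCayleyGraph_adj _ _).1 hvx).2 hx

theorem SimpleGraph.IsPrimeGraph.jacobson_eq_bot [Finite R]
    (h : (unitaryCayleyGraph R).IsPrimeGraph) :
    Ring.jacobson R = ⊥ := by
  by_contra hJ
  have hnt : (Ring.jacobson R : Set R).Nontrivial := by
    obtain ⟨x, hx, hx0⟩ := Submodule.exists_mem_ne_zero_of_ne_bot hJ
    exact ⟨x, hx, 0, zero_mem _, hx0⟩
  have : Nontrivial R := Set.nontrivial_of_nontrivial hnt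
  exact (Ring.jacobson_lt_top R).ne
    (SetLike.coe_injective (h _ unitaryCayleyGraph_isHomogeneousSet_jacobson hnt))

theorem IsField.not_isPrimeGraph_unitaryCayleyGraph (hF : IsField R) (hR : Nat.card R ≠ 2) :
    ¬ (unitaryCayleyGraph R).IsPrimeGraph := by
  intro h
  have := hF.nontrivial
  have hu : ({0}ᶜ : Set R) = Set.univ := by
    refine h _ (fun v hv => Or.inl fun x hx => ?_) ?_
    · obtain rfl : v = 0 := by simpa using hv
      rw [unitaryCayleyGraph_adj_of_nontrivial, zero_sub, IsUnit.neg_iff]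
      obtain ⟨y, hy⟩ := hF.mul_inv_cancel hx
      exact ⟨⟨x, y, hy, by rw [hF.mul_comm, hy]⟩, rfl⟩
    · by_contra hn
      rw [Set.not_nontrivial_iff] at hn
      refine hR (Nat.card_eq_two_iff.2 ⟨0, 1, zero_ne_one, Set.eq_univ_of_forall fun x => ?_⟩)
      by_cases hx : x = 0
      · exact Or.inl hx
      · exact Or.inr (hn hx one_ne_zero)
  have : (0 : R) ∈ ({0}ᶜ : Set R) := hu ▸ Set.mem_univ _
  exact this rfl

theorem eq_zero_or_eq_one_of_card_eq_two {K : Type*} [Field K] (hK : Nat.card K = 2) (x : K) :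
    x = 0 ∨ x = 1 :=
  or_iff_not_imp_left.2 fun hx => ((Nat.card_eq_two_iff' (0 : K)).1 hK).unique hx one_ne_zero

/-- Two distinct quotients of order two disconnect the unitary Cayley graph. -/
theorem not_isPrimeGraph_unitaryCayleyGraph_of_card_eq_two {K L : Type*} [Field K] [Field L]
    (hK : Nat.card K = 2) (hL : Nat.card L = 2) (f : R →+* K) (g : R →+* L)
    (hfg : ∃ x, f x = 1 ∧ g x = 0) : ¬ (unitaryCayleyGraph R).IsPrimeGraph := by
  intro h
  have : Nontrivial R := f.domain_nontrivial
  have hu : {x : R | f x = 0 ↔ g x = 0} = Set.univ := by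
    -- Along an edge both `f` and `g` change value, so no edge leaves the set where they vanish
    -- together.
    refine h _ (fun v hv => Or.inr fun x hx hvx => hv ?_) ⟨0, by simp, 1, by simp, zero_ne_one⟩
    rw [unitaryCayleyGraph_adj_of_nontrivial] at hvx
    have h1 := (hvx.map f).ne_zero
    have h2 := (hvx.map g).ne_zero
    rw [map_sub] at h1 h2
    simp only [Set.mem_ofPred_eq] at hx ⊢
    rcases eq_zero_or_eq_one_of_card_eq_two hK (f v) with a | a <;>
    rcases eq_zero_or_eq_one_of_card_eq_two hK (f x) with b | b <;>
    rcases eq_zero_or_eq_one_of_card_eq_two hL (g v) with c | c <;>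
    rcases eq_zero_or_eq_one_of_card_eq_two hL (g x) with d | d <;> simp_all
  obtain ⟨x, hx1, hx0⟩ := hfg
  have hx : x ∈ {x : R | f x = 0 ↔ g x = 0} := hu ▸ Set.mem_univ x
  exact one_ne_zero (hx1 ▸ hx.2 hx0)

end Ring

/-! ### Additive generation by units in products of fields and matrix rings. -/

section Product

variable {ι κ : Type*} {K : ι → Type*} [∀ i, Field (K i)] {n : κ → Type*} [∀ j, Fintype (n j)]
  [∀ j, DecidableEq (n j)] {F : κ → Type*} [∀ j, Field (F j)]

/-- Off-diagonal elementary matrices are unipotents minus `1`; diagonal ones are products of two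
off-diagonal ones, hence the subring closure. -/
theorem inr_single_matrix_mem_closure_units [DecidableEq κ] [∀ j, Nontrivial (n j)]
    (j : κ) (M : Matrix (n j) (n j) (F j)) :
    ((0, Pi.single j M) : (∀ i, K i) × ∀ j, Matrix (n j) (n j) (F j)) ∈
      Subring.closure {x | IsUnit x} := by
  have hsingle : ∀ (a b : n j) (c : F j), a ≠ b →
      ((0, Pi.single j (Matrix.single a b c)) : (∀ i, K i) × ∀ j, Matrix (n j) (n j) (F j)) ∈
        Subring.closure {x | IsUnit x} := by
    intro a b c hab
    set x : (∀ i, K i) × ∀ j, Matrix (n j) (n j) (F j) := (0, Pi.single j (Matrix.single a b c))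
    have hx : x * x = 0 := by
      simp [x, ← Pi.single_mul, Matrix.single_mul_single_of_ne _ _ _ _ hab.symm]
    have hu : IsUnit (1 + x) := IsNilpotent.isUnit_one_add ⟨2, by rw [pow_two, hx]⟩
    simpa using sub_mem (Subring.subset_closure (show 1 + x ∈ {x | IsUnit x} from hu))
      (one_mem (Subring.closure _))
  induction M using Matrix.induction_on' with
  | h_zero => rw [Pi.single_zero]; exact zero_mem _
  | h_add p q hp hq => simpa [Pi.single_add] using add_mem hp hq
  | h_std_basis a b c =>
    by_cases hab : a = b
    · subst hab
      obtain ⟨b, hb⟩ := exists_ne a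
      simpa [← Pi.single_mul] using mul_mem (hsingle a b c hb.symm) (hsingle b a 1 hb)
    · exact hsingle a b c hab

theorem inl_single_mem_closure_units [DecidableEq ι] (i : ι) (hi : Nat.card (K i) ≠ 2) (x : K i) :
    ((Pi.single i x, 0) : (∀ i, K i) × ∀ j, Matrix (n j) (n j) (F j)) ∈
      Subring.closure {x | IsUnit x} := by
  -- `x` will be the difference of the nonzero elements `x + v` and `v`.
  have hex : ∃ v : K i, v ≠ 0 ∧ x + v ≠ 0 := by
    by_contra! h
    have h1 : x = -1 := eq_neg_of_add_eq_zero_left (h 1 one_ne_zero)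
    refine hi (Nat.card_eq_two_iff.2 ⟨0, 1, zero_ne_one, Set.eq_univ_of_forall fun v => ?_⟩)
    refine or_iff_not_imp_left.2 fun hv => ?_
    have := h v hv
    rw [h1] at this
    exact (neg_add_eq_zero.1 this).symm
  obtain ⟨v, hv, hxv⟩ := hex
  have hu : ∀ w : K i, w ≠ 0 → ((Function.update 1 i w, 1) :
      (∀ i, K i) × ∀ j, Matrix (n j) (n j) (F j)) ∈ Subring.closure {x | IsUnit x} := by
    intro w hw
    refine Subring.subset_closure ?_
    refine Prod.isUnit_iff.2 ⟨Pi.isUnit_iff.2 fun i' => ?_, isUnit_one⟩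
    by_cases h : i' = i
    · subst h; simpa using hw
    · simp [h]
  convert! sub_mem (hu _ hxv) (hu _ hv) using 1
  ext i' : 2
  · by_cases h : i' = i
    · subst h; simp
    · simp [h]
  · simp

/-- A product of fields and matrix rings of size at least two, with at most one factor of order
two, is additively generated by its units. -/
theorem addSubgroupClosure_units_prod_matrix_eq_top [Finite ι] [Finite κ]
    [∀ j, Nontrivial (n j)]
    (hK : ∀ i j : ι, Nat.card (K i) = 2 → Nat.card (K j) = 2 → i = j) :
    AddSubgroup.closure {x : (∀ i, K i) × ∀ j, Matrix (n j) (n j) (F j) | IsUnit x} = ⊤ := by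
  classical
  cases nonempty_fintype ι
  cases nonempty_fintype κ
  set P := (∀ i, K i) × ∀ j, Matrix (n j) (n j) (F j)
  -- Units are closed under multiplication, so the subring they generate is their additive span.
  suffices h : ∀ x : P, x ∈ Subring.closure {x : P | IsUnit x} by
    refine eq_top_iff.2 fun x _ => ?_
    have := Subring.mem_closure_iff.1 (h x)
    have hs : (Submonoid.closure {x : P | IsUnit x} : Set P) = {x : P | IsUnit x} :=
      congrArg _ (Submonoid.closure_eq (IsUnit.submonoid P))
    rwa [hs] at this
  have hzero : ∀ x : P, (∀ i, Nat.card (K i) = 2 → x.1 i = 0) →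
      x ∈ Subring.closure {x : P | IsUnit x} := by
    intro x hx
    have hsum : x = ∑ i, ((Pi.single i (x.1 i), 0) : P) + ∑ j, ((0, Pi.single j (x.2 j)) : P) := by
      ext i : 2 <;> simp [Prod.fst_sum, Prod.snd_sum, Finset.univ_sum_single]
    rw [hsum]
    refine add_mem (sum_mem fun i _ => ?_) (sum_mem fun j _ =>
      inr_single_matrix_mem_closure_units j _)
    by_cases hi : Nat.card (K i) = 2
    · rw [hx i hi, Pi.single_zero]; exact zero_mem _
    · exact inl_single_mem_closure_units i hi _
  intro x
  by_cases h : ∀ i, Nat.card (K i) = 2 → x.1 i = 0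
  · exact hzero x h
  · push Not at h
    obtain ⟨i, hi, hxi⟩ := h
    -- In the only factor of order two `x` has component `1`, so `x - 1` vanishes there.
    have := add_mem (hzero (x - 1) fun i' hi' => ?_) (one_mem _)
    · simpa using this
    · obtain rfl := hK i i' hi hi'
      exact sub_eq_zero.2 ((eq_zero_or_eq_one_of_card_eq_two hi _).resolve_left hxi)

end Product

/-! ### Artin–Wedderburn decompositions. -/

theorem RingEquiv.addSubgroupClosure_units_eq_top {R S : Type*} [Ring R] [Ring S] (e : R ≃+* S)
    (h : AddSubgroup.closure {x : S | IsUnit x} = ⊤) :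
    AddSubgroup.closure {x : R | IsUnit x} = ⊤ := by
  refine eq_top_iff.2 fun r _ => ?_
  have hr : e r ∈ AddSubgroup.closure {x : S | IsUnit x} := h ▸ AddSubgroup.mem_top _
  rw [← e.symm_apply_apply r]
  generalize e r = s at hr
  induction hr using AddSubgroup.closure_induction with
  | mem t ht => exact AddSubgroup.subset_closure (ht.map e.symm)
  | zero => simp
  | add a b _ _ ha hb => rw [map_add]; exact add_mem ha hb
  | neg a _ ha => rw [map_neg]; exact neg_mem ha

theorem Matrix.exists_ringEquiv_of_card_eq_one {n : Type*} [Fintype n] [DecidableEq n]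
    (K : Type*) [Ring K] (hn : Fintype.card n = 1) : Nonempty (Matrix n n K ≃+* K) := by
  obtain ⟨h⟩ := (Fintype.card_eq_one_iff_nonempty_unique (α := n)).1 hn
  obtain rfl : ‹Fintype n› = Unique.fintype := Subsingleton.elim _ _
  exact ⟨Matrix.uniqueRingEquiv⟩

namespace ArtinWedderburnDecomposition

attribute [instance] fieldK finiteK fieldF finiteF

variable {A : Type u} [Ring A]

/-- The zero ring, `s = r = 0`, stands apart: it is not a field, yet has no nontrivial idempotent.
-/
theorem exists_isIdempotentElem (D : ArtinWedderburnDecomposition A) :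
    (D.s = 1 ∧ D.r = 0) ∨ Subsingleton A ∨ ∃ e : A, IsIdempotentElem e ∧ e ≠ 0 ∧ e ≠ 1 := by
  suffices h : (D.s = 1 ∧ D.r = 0) ∨ (D.s = 0 ∧ D.r = 0) ∨
      ∃ e : (∀ i, D.K i) × (∀ j, Matrix (Fin (D.d j)) (Fin (D.d j)) (D.F j)),
        IsIdempotentElem e ∧ e ≠ 0 ∧ e ≠ 1 by
    refine h.imp_right (Or.imp (fun ⟨hs, hr⟩ => ?_) fun ⟨e, he, h0, h1⟩ => ?_)
    · have : IsEmpty (Fin D.s) := by rw [hs]; infer_instance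
      have : IsEmpty (Fin D.r) := by rw [hr]; infer_instance
      exact D.equiv.toEquiv.subsingleton
    · exact ⟨D.equiv.symm e, he.map D.equiv.symm, by simpa using h0, by simpa using h1⟩
  rcases Nat.eq_zero_or_pos D.r with hr | hr
  · rcases Nat.lt_trichotomy D.s 1 with hs | hs | hs
    · exact Or.inr (Or.inl ⟨by omega, hr⟩)
    · exact Or.inl ⟨hs, hr⟩
    · refine Or.inr (Or.inr ⟨(Pi.single ⟨0, by omega⟩ 1, 0), ?_, fun h => ?_, fun h => ?_⟩)
      · simp [IsIdempotentElem, ← Pi.single_mul]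
      · simpa using congrFun (congrArg Prod.fst h) ⟨0, by omega⟩
      · simpa using congrFun (congrArg Prod.fst h) ⟨1, hs⟩
  · let j : Fin D.r := ⟨0, hr⟩
    have hd := D.two_le_d j
    let a : Fin (D.d j) := ⟨0, by omega⟩
    let b : Fin (D.d j) := ⟨1, by omega⟩
    have hab : a ≠ b := by simp [a, b]
    refine Or.inr (Or.inr ⟨(0, Pi.single j (Matrix.single a a 1)), ?_, fun h => ?_, fun h => ?_⟩)
    · simp [IsIdempotentElem, ← Pi.single_mul]
    · simpa using congrFun (congrFun (congrFun (congrArg Prod.snd h) j) a) a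
    · simpa [Matrix.single_apply, hab] using
        congrFun (congrFun (congrFun (congrArg Prod.snd h) j) b) b

/-- The projection onto a field factor of the decomposition. -/
def evalField (D : ArtinWedderburnDecomposition A) (i : Fin D.s) : A →+* D.K i :=
  (Pi.evalRingHom D.K i).comp ((RingHom.fst _ _).comp D.equiv.toRingHom)

theorem isField_iff (D : ArtinWedderburnDecomposition A) : IsField A ↔ D.s = 1 ∧ D.r = 0 := by
  refine ⟨fun hA => ?_, fun ⟨hs, hr⟩ => ?_⟩
  · let := hA.toField
    rcases D.exists_isIdempotentElem with h | h | ⟨e, he, h0, h1⟩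
    · exact h
    · exact absurd h (not_subsingleton A)
    · exact absurd (IsIdempotentElem.iff_eq_zero_or_one.1 he) (by tauto)
  · have : Unique (Fin D.s) := by rw [hs]; infer_instance
    have : IsEmpty (Fin D.r) := by rw [hr]; infer_instance
    have hf : Function.Bijective (D.evalField default) := by
      refine ⟨fun x y hxy => D.equiv.injective (Prod.ext (funext fun i => ?_)
        (Subsingleton.elim _ _)), fun x => ⟨D.equiv.symm (Pi.single default x, 0), ?_⟩⟩
      · rw [Unique.eq_default i]; exact hxy
      · simp [evalField]
    exact MulEquiv.isField (Field.toIsField (D.K default)) (RingEquiv.ofBijective _ hf).toMulEquiv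

theorem addSubgroupClosure_units_eq_top (D : ArtinWedderburnDecomposition A)
    (hK : ∀ i j : Fin D.s, Nat.card (D.K i) = 2 → Nat.card (D.K j) = 2 → i = j) :
    AddSubgroup.closure {x : A | IsUnit x} = ⊤ := by
  have : ∀ j, Nontrivial (Fin (D.d j)) := fun j => Fin.nontrivial_iff_two_le.2 (D.two_le_d j)
  exact D.equiv.addSubgroupClosure_units_eq_top (addSubgroupClosure_units_prod_matrix_eq_top hK)

theorem isPrimeGraph (D : ArtinWedderburnDecomposition A) [Finite A] (hJ : Ring.jacobson A = ⊥)
    (hK : ∀ i j : Fin D.s, Nat.card (D.K i) = 2 → Nat.card (D.K j) = 2 → i = j)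
    (hA : ¬ IsField A) : (unitaryCayleyGraph A).IsPrimeGraph := by
  rcases D.exists_isIdempotentElem with h | h | ⟨e, he, h0, h1⟩
  · exact absurd (D.isField_iff.2 h) hA
  · exact fun X _ hX => absurd hX (Set.not_nontrivial_iff.2 Set.subsingleton_of_subsingleton)
  · exact unitaryCayleyGraph_isPrimeGraph hJ (D.addSubgroupClosure_units_eq_top hK)
      (closure_nonunits_eq_top_of_isIdempotentElem he h0 h1)

theorem eq_of_card_eq_two (D : ArtinWedderburnDecomposition A)
    (h : (unitaryCayleyGraph A).IsPrimeGraph) (i j : Fin D.s) (hi : Nat.card (D.K i) = 2)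
    (hj : Nat.card (D.K j) = 2) : i = j := by
  by_contra hij
  refine not_isPrimeGraph_unitaryCayleyGraph_of_card_eq_two hi hj (D.evalField i)
    (D.evalField j)
    ⟨D.equiv.symm (Pi.single i 1, 0), ?_, ?_⟩ h
  · simp [evalField]
  · simp [evalField, Ne.symm hij]

end ArtinWedderburnDecomposition

/-- The **Wedderburn–Artin theorem** for finite semisimple rings. -/
theorem ArtinWedderburnDecomposition.nonempty (A : Type u) [Ring A] [Finite A]
    [IsSemisimpleRing A] : Nonempty (ArtinWedderburnDecomposition A) := by
  obtain ⟨n, D, d, _, hd, ⟨e⟩⟩ := IsSemisimpleRing.exists_ringEquiv_pi_matrix_divisionRing A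
  have hfin : ∀ i, Finite (D i) := fun i => by
    have := hd i
    have : Finite (Matrix (Fin (d i)) (Fin (d i)) (D i)) :=
      Finite.of_surjective (fun a => e a i) ((Function.surjective_eval i).comp e.surjective)
    exact Finite.of_injective (Matrix.scalar (Fin (d i))) fun _ _ => (Matrix.scalar_inj (n := Fin (d i)) (α := D i)).1
  let : ∀ i, Field (D i) := fun i => littleWedderburn (D i)
  -- Blocks of size one become the field factors.
  let p : Fin n → Prop := fun i => d i = 1
  let es := (Fintype.equivFin {i // p i}).symm
  let er := (Fintype.equivFin {i // ¬ p i}).symm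
  have h1 : ∀ i : {i // p i}, Nonempty (Matrix (Fin (d i)) (Fin (d i)) (D i) ≃+* D i) := fun i =>
    Matrix.exists_ringEquiv_of_card_eq_one _ ((Fintype.card_fin _).trans i.2)
  refine ⟨{
    s := _
    r := _
    K := fun i => D (es i)
    d := fun j => d (er j)
    two_le_d := fun j => by
      have := (hd (er j)).out
      have : d (er j) ≠ 1 := (er j).2
      omega
    F := fun j => D (er j)
    equiv := (e.trans (RingEquiv.piEquivPiSubtypeProd p _)).trans (RingEquiv.prodCongr
      ((RingEquiv.piCongrRight fun i => (h1 i).some).trans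
        (RingEquiv.piCongrLeft (fun i : {i // p i} => D i) es).symm)
      (RingEquiv.piCongrLeft
        (fun i : {i // ¬ p i} => Matrix (Fin (d i)) (Fin (d i)) (D i)) er).symm) }⟩

/-! ### The main theorem. -/

theorem mainTheorem6 (R : Type u) [Ring R] [Finite R] (hR : Nat.card R ≠ 2) :
    Nonempty (ArtinWedderburnDecomposition (SemisimpleQuotient R)) ∧
    ∀ D : ArtinWedderburnDecomposition (SemisimpleQuotient R),
      ((unitaryCayleyGraph R).IsPrimeGraph ↔
        Ring.jacobson R = ⊥ ∧
        (∀ i j : Fin D.s, Nat.card (D.K i) = 2 → Nat.card (D.K j) = 2 → i = j) ∧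
        ¬ IsField (SemisimpleQuotient R)) ∧
      (IsField (SemisimpleQuotient R) ↔ D.s = 1 ∧ D.r = 0) := by
  have : Finite (SemisimpleQuotient R) := Finite.of_surjective _ Ideal.Quotient.mk_surjective
  refine ⟨ArtinWedderburnDecomposition.nonempty _, fun D => ⟨?_, D.isField_iff⟩⟩
  have key : Ring.jacobson R = ⊥ → ∃ e : R ≃+* SemisimpleQuotient R, True := fun hJ =>
    ⟨RingEquiv.ofBijective (Ideal.Quotient.mk (Ring.jacobson R))
      ⟨(RingHom.injective_iff_ker_eq_bot _).2 (by rw [Ideal.mk_ker, hJ]),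
        Ideal.Quotient.mk_surjective⟩, trivial⟩
  constructor
  · intro h
    have hJ := h.jacobson_eq_bot
    obtain ⟨e, -⟩ := key hJ
    -- With zero radical, the decomposition of the quotient is one of `R`, with the same factors.
    let D' : ArtinWedderburnDecomposition R := { D with equiv := e.trans D.equiv }
    exact ⟨hJ, D'.eq_of_card_eq_two h, fun hF =>
      (e.toMulEquiv.isField hF).not_isPrimeGraph_unitaryCayleyGraph hR h⟩
  · rintro ⟨hJ, hK, hF⟩
    obtain ⟨e, -⟩ := key hJ
    let D' : ArtinWedderburnDecomposition R := { D with equiv := e.trans D.equiv }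
    exact D'.isPrimeGraph hJ hK fun h => hF (e.symm.toMulEquiv.isField h)
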